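/- Let $\mathfrak h$ be the Cartan subalgebra of a finite-dimensional simple complex Lie algebra of type $X_N$ ($X=A,D,E$), with root system $R\subset\mathfrak h$, Weyl group $W$, root lattice $Q=\mathbb ZR$, and the $W$-invariant symmetric bilinear form $(\cdot|\cdot)$ normalized by $(\alpha|\alpha)=2$ for $\alpha\in R$. For an integral lattice $L$ (with nondegenerate symmetric form, $H=\mathbb C\otimes_{\mathbb Z}L$) fix a bimultiplicative cocycle $\varepsilon\colon L\times L\to\{\pm1\}$ with $\varepsilon(x,x)=(-1)^{|x|^2(|x|^2+1)/2}$, $|x|^2=(x|x)$. Let $\mathcal F_H=S(H[t^{-1}]t^{-1})$ be the Fock space of the Heisenberg algebra $\hat H$ and $V_L=\mathcal F_H\otimes\mathbb C_\varepsilon[L]$ the lattice vertex (super)algebra. Let $e^\alpha_{(n)}$ be the coefficient of $\zeta^{-n-1}$ in $$Y(e^\alpha,\zeta)=e^\alpha\zeta^{\alpha_0}\exp\Big(\sum_{n<0}\alpha_n\frac{\zeta^{-n}}{-n}\Big)\exp\Big(\sum_{n>0}\alpha_n\frac{\zeta^{-n}}{-n}\Big),\qquad \alpha\in L .$$ Let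 $\varepsilon_Q$ be such a cocycle on $Q$, used in $V_Q$, and let $\mathcal W_{X_N}\subset\mathcal F_{\mathfrak h}=\mathcal F_{\mathfrak h}\otimes e^0\subset V_Q$ be the intersection of $\mathcal F_{\mathfrak h}$ with the kernels of all screening operators $e^\alpha_{(0)}$, $\alpha\in R$. Suppose $\lambda_0\in\mathfrak h$ satisfies $(\lambda_0|\alpha)\in\{0,\pm1\}$ for every $\alpha\in R$. By a lift of $\lambda_0$ we mean a vector $\tilde\lambda_0=(\lambda_0,\kappa)\in L$, where $K$ is a complex vector space with a bilinear form and $L$ is an integral lattice in the orthogonal sum $\mathfrak h\oplus K$ (that is, $L$ is generated by a $\mathbb C$-basis of $\mathfrak h\oplus K$, and the form on $\mathfrak h\oplus K$ is nondegenerate, symmetric and integer-valued on $L$), containing $Q$ and equipped with a cocycle $\varepsilon$ as above that extends $\varepsilon_Q$. The group $W$ acts on $\mathfrak h\oplus K$ through the first summand. Then: 1. Lifts exist: for every integer $n\ne(\lambda_0|\lambda_0)$ there is a lift with $K=\mathbb C$ and $|\tilde\lambda_0|^2=n$. 2. For every lift and every integer $d\ge1$, the element $$\nu^d=\sum_{\lambda\in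 W\tilde\lambda_0}{e^{\lambda}}_{(-d)}\,e^{-\lambda}\in V_L$$ lies in the Fock space $\mathcal F_{\mathfrak h\oplus K}=\mathcal F_{\mathfrak h\oplus K}\otimes e^0$, satisfies $e^\alpha_{(0)}\nu^d=0$ for all $\alpha\in R$, and its image in $\mathcal F_{\mathfrak h}$ under the map of Fock spaces induced by the projection $\mathfrak h\oplus K\to\mathfrak h$ (that is, $\nu^d$ modulo $K$) belongs to $\mathcal W_{X_N}$. In particular, for $K=0$ the element $\nu^d$ itself lies in $\mathcal W_{X_N}$. -/

import Mathlib

noncomputable section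

namespace LatticeVOA

section Fock

variable (H : Type*) [AddCommGroup H] [Module ℂ H]

/-- The bosonic Fock space `S(H[t⁻¹]t⁻¹)`. An element of `H[t⁻¹]t⁻¹` is a finitely supported
function `ℕ → H`, where `Finsupp.single m a` stands for `a t^{-(m+1)}`. -/
abbrev Fock : Type _ := SymmetricAlgebra ℂ (ℕ →₀ H)

variable {H}

/-- The vector `a t^{-(m+1)}` of the Fock space. -/
def gen (m : ℕ) (a : H) : Fock H := SymmetricAlgebra.ι ℂ (ℕ →₀ H) (Finsupp.single m a)

/-- The homomorphism of Fock spaces induced by a linear map `f`: it sends `a t^{-(m+1)}` to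
`f(a) t^{-(m+1)}`. -/
def Fock.map {H' : Type*} [AddCommGroup H'] [Module ℂ H'] (f : H →ₗ[ℂ] H') :
    Fock H →ₐ[ℂ] Fock H' :=
  SymmetricAlgebra.lift (SymmetricAlgebra.ι ℂ (ℕ →₀ H') ∘ₗ Finsupp.mapRange.linearMap f)

/-- For a linear functional `φ` on `H[t⁻¹]t⁻¹`, the algebra homomorphism `x ↦ x + ε D x` to the
dual numbers over the Fock space, where `D` is the derivation extending `φ`. -/
def dualHom (φ : (ℕ →₀ H) →ₗ[ℂ] ℂ) :
    Fock H →ₐ[ℂ] TrivSqZeroExt (Fock H) (Fock H) :=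
  SymmetricAlgebra.lift
    (((TrivSqZeroExt.inlAlgHom ℂ (Fock H) (Fock H)).toLinearMap ∘ₗ
        SymmetricAlgebra.ι ℂ (ℕ →₀ H)) +
      ((TrivSqZeroExt.inrHom (Fock H) (Fock H)).restrictScalars ℂ ∘ₗ
        (Algebra.linearMap ℂ (Fock H) ∘ₗ φ)))

/-- The derivation of the Fock space that extends the linear functional `φ` on `H[t⁻¹]t⁻¹`
(see `contract_ι`, `contract_one` and `contract_mul`). -/
def contract (φ : (ℕ →₀ H) →ₗ[ℂ] ℂ) : Fock H →ₗ[ℂ] Fock H :=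
  (TrivSqZeroExt.sndHom (Fock H) (Fock H)).restrictScalars ℂ ∘ₗ (dualHom φ).toLinearMap

theorem contract_ι (φ : (ℕ →₀ H) →ₗ[ℂ] ℂ) (u : ℕ →₀ H) :
    contract φ (SymmetricAlgebra.ι ℂ (ℕ →₀ H) u) = algebraMap ℂ (Fock H) (φ u) := by
  simp [contract, dualHom, Algebra.algebraMap_eq_smul_one]

theorem contract_one (φ : (ℕ →₀ H) →ₗ[ℂ] ℂ) : contract φ (1 : Fock H) = 0 := by
  simp [contract]

theorem fst_dualHom (φ : (ℕ →₀ H) →ₗ[ℂ] ℂ) (x : Fock H) : (dualHom φ x).fst = x := by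
  have h : (TrivSqZeroExt.fstHom ℂ (Fock H) (Fock H)).comp (dualHom φ) =
      AlgHom.id ℂ (Fock H) := by
    apply SymmetricAlgebra.algHom_ext
    ext u
    simp [dualHom]
  exact DFunLike.congr_fun h x

theorem contract_mul (φ : (ℕ →₀ H) →ₗ[ℂ] ℂ) (x y : Fock H) :
    contract φ (x * y) = x * contract φ y + y * contract φ x := by
  simp [contract, fst_dualHom, mul_comm]

/-- For `m : ℕ`, the action of `a_{m+1} = a t^{m+1}` on the Fock space: the derivation with
`b t^{-(k+1)} ↦ (m+1) δ_{m,k} (a|b)`. -/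
def annihilate (B : LinearMap.BilinForm ℂ H) (a : H) (m : ℕ) : Fock H →ₗ[ℂ] Fock H :=
  contract (((m : ℂ) + 1) • (B a ∘ₗ Finsupp.lapply m))

end Fock

/-- The exponential `∑ₖ fᵏ / k!` of a formal power series `f` with zero constant term and
coefficients in a (not necessarily commutative) `ℂ`-algebra; only the terms with `k ≤ n`
contribute to the `n`-th coefficient. -/
def expSeries {A : Type*} [Ring A] [Algebra ℂ A] (f : PowerSeries A) : PowerSeries A :=
  PowerSeries.mk fun n =>
    ∑ k ∈ Finset.range (n + 1), ((k.factorial : ℂ)⁻¹) • PowerSeries.coeff n (f ^ k)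

section Lattice

variable {H : Type*} [AddCommGroup H] [Module ℂ H]

/-- `L` is an integral lattice in `H = ℂ ⊗ L` for the nondegenerate symmetric form `B`. -/
structure IsIntegralLattice (B : LinearMap.BilinForm ℂ H) (L : AddSubgroup H) : Prop where
  symm : B.IsSymm
  nondegenerate : B.Nondegenerate
  basis : ∃ (n : ℕ) (b : Module.Basis (Fin n) ℂ H), L = AddSubgroup.closure (Set.range b)
  integral : ∀ x ∈ L, ∀ y ∈ L, ∃ n : ℤ, B x y = n

/-- `ε` is a bimultiplicative `2`-cocycle `L × L → {±1}` with
`ε(x, x) = (-1)^{|x|² (|x|² + 1) / 2}`, where `|x|² = (x|x)`. -/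
structure IsCocycle (B : LinearMap.BilinForm ℂ H) (L : AddSubgroup H) (ε : L → L → ℤˣ) :
    Prop where
  add_left : ∀ x y z, ε (x + y) z = ε x z * ε y z
  add_right : ∀ x y z, ε x (y + z) = ε x y * ε x z
  diag : ∀ (x : L) (n : ℤ), B x x = n → ε x x = (-1) ^ (n * (n + 1) / 2)

/-- The space of states `V_L = F ⊗ ℂ_ε[L]` of the lattice vertex algebra; `x ⊗ e^β` is
`Finsupp.single β x`. -/
abbrev VL (L : AddSubgroup H) : Type _ := L →₀ Fock H

variable {L : AddSubgroup H}

/-- The vector `e^β = 1 ⊗ e^β` of `V_L`. -/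
def expVec (β : L) : VL L := Finsupp.single β 1

/-- The action on `V_L` of the element `a_n = a t^n` of the Heisenberg algebra (with central
element acting as the identity). -/
def heis (B : LinearMap.BilinForm ℂ H) (a : H) : ℤ → Module.End ℂ (VL L)
  | Int.ofNat 0 => Finsupp.lsum ℂ fun β : L => B a β • Finsupp.lsingle β
  | Int.ofNat (m + 1) => Finsupp.mapRange.linearMap (annihilate B a m)
  | Int.negSucc m => Finsupp.mapRange.linearMap (LinearMap.mulLeft ℂ (gen m a))

/-- Left multiplication by `e^α` on `V_L`: `x ⊗ e^β ↦ ε(α, β) x ⊗ e^{α + β}`. -/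
def mulExp (ε : L → L → ℤˣ) (α : L) : Module.End ℂ (VL L) :=
  Finsupp.lsum ℂ fun β : L => ((ε α β : ℤ) : ℂ) • Finsupp.lsingle (α + β)

/-- `exp (∑_{n<0} α_n ζ^{-n} / (-n))`, a power series in `ζ` with coefficients in `End V_L`. -/
def expMinus (B : LinearMap.BilinForm ℂ H) (α : L) : PowerSeries (Module.End ℂ (VL L)) :=
  expSeries (PowerSeries.mk fun m : ℕ =>
    if m = 0 then 0 else ((m : ℂ)⁻¹) • heis B (α : H) (-(m : ℤ)))

/-- `exp (∑_{n>0} α_n ζ^{-n} / (-n))`, a power series in `ζ⁻¹` with coefficients in `End V_L`. -/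
def expPlus (B : LinearMap.BilinForm ℂ H) (α : L) : PowerSeries (Module.End ℂ (VL L)) :=
  expSeries (PowerSeries.mk fun m : ℕ =>
    if m = 0 then 0 else (-(m : ℂ)⁻¹) • heis B (α : H) (m : ℤ))

/-- The mode `e^α_(n)`, that is, the coefficient of `ζ^{-n-1}` in the field
`Y(e^α, ζ) = e^α ζ^{α_0} exp(∑_{n<0} α_n ζ^{-n}/(-n)) exp(∑_{n>0} α_n ζ^{-n}/(-n))`, applied to a
vector of `V_L`. On the component `x ⊗ e^β`, the `j`-th coefficient of the first exponential, the
`k`-th coefficient of the second one and `ζ^{α_0} = ζ^{(α|β)}` contribute to the power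
`ζ^{j - k + (α|β)}`; only finitely many pairs `(j, k)` give a nonzero contribution. -/
def mode (B : LinearMap.BilinForm ℂ H) (ε : L → L → ℤˣ) (α : L) (n : ℤ) (v : VL L) : VL L :=
  v.sum fun β x =>
    ∑ᶠ (j : ℕ) (k : ℕ) (_ : (j : ℂ) - (k : ℂ) + B α β = -(n : ℂ) - 1),
      mulExp ε α (PowerSeries.coeff j (expMinus B α)
        (PowerSeries.coeff k (expPlus B α) (Finsupp.single β x)))

end Lattice

section RootSystem

variable {ι h N : Type*} [AddCommGroup h] [Module ℂ h] [AddCommGroup N] [Module ℂ N]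

/-- The root lattice. -/
def rootLattice (P : RootPairing ι ℂ h N) : AddSubgroup h :=
  AddSubgroup.closure (Set.range P.root)

/-- The `W`-algebra of the root system: the intersection of the Fock space `F = F ⊗ e^0 ⊂ V_Q`
with the kernels of all screening operators `e^α_(0)`, `α` a root. -/
def WAlgebra (P : RootPairing ι ℂ h N) (B : LinearMap.BilinForm ℂ h)
    (ε : rootLattice P → rootLattice P → ℤˣ) : Set (VL (rootLattice P)) :=
  {v | (∃ x : Fock h, v = Finsupp.single 0 x) ∧
    ∀ α : rootLattice P, (α : h) ∈ Set.range P.root → mode B ε α 0 v = 0}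

variable {K : Type*} [AddCommGroup K] [Module ℂ K]

/-- The orthogonal direct sum of two bilinear forms. -/
def prodForm (B : LinearMap.BilinForm ℂ h) (C : LinearMap.BilinForm ℂ K) :
    LinearMap.BilinForm ℂ (h × K) :=
  B.compl₁₂ (LinearMap.fst ℂ h K) (LinearMap.fst ℂ h K) +
    C.compl₁₂ (LinearMap.snd ℂ h K) (LinearMap.snd ℂ h K)

/-- `L`, with its cocycle `ε`, is an integral lattice in the orthogonal sum `h ⊕ K` that contains
the lattice `Q ⊂ h` with its cocycle `εQ`. -/
structure IsLatticeExtension (B : LinearMap.BilinForm ℂ h) (Q : AddSubgroup h) (εQ : Q → Q → ℤˣ)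
    (C : LinearMap.BilinForm ℂ K) (L : AddSubgroup (h × K)) (ε : L → L → ℤˣ) : Prop where
  lattice : IsIntegralLattice (prodForm B C) L
  cocycle : IsCocycle (prodForm B C) L ε
  incl : ∀ x : Q, ((x : h), (0 : K)) ∈ L
  extends_cocycle : ∀ x y : Q, ε ⟨((x : h), 0), incl x⟩ ⟨((y : h), 0), incl y⟩ = εQ x y

/-- The element `∑_{λ ∈ W l₀} e^λ_(-d) e^{-λ}` of `V_L`, for `L ⊂ h ⊕ K` and `l₀ = (lam, κ)` in
`L`, where the Weyl group `W` acts on `h ⊕ K` through the first summand. -/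
def nu (P : RootPairing ι ℂ h N) (B : LinearMap.BilinForm ℂ h) (C : LinearMap.BilinForm ℂ K)
    (L : AddSubgroup (h × K)) (ε : L → L → ℤˣ) (lam : h) (κ : K) (d : ℕ) : VL L :=
  ∑ᶠ (l : L) (_ : (l : h × K).1 ∈ MulAction.orbit P.weylGroup lam ∧ (l : h × K).2 = κ),
    mode (prodForm B C) ε l (-(d : ℤ)) (expVec (-l))

end RootSystem

end LatticeVOA

end

/-!
For `a ∈ H` let `Sⱼ(a)` (`schur a j`) be the coefficient of `wʲ` in
`E(a, w) = exp (∑_{m>0} a_{-m} wᵐ / m)`. Since `(λ|-λ) = -|λ|²`, the vector `e^λ_(-d) e^{-λ}` is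
`ε(λ, -λ) Sⱼ(λ) ⊗ e^0` with `j = |λ|² + d - 1` (`mode_expVec`). Bimultiplicativity turns
`ε(λ, -λ)` into `ε(λ, λ)⁻¹`, which depends on `|λ|²` only, so both the sign and the index are
constant along a Weyl group orbit: up to a sign, `ν^d` is the sum of `Sⱼ(λ)` over the orbit
(`nu_eq`).

The operators `α_m`, `m > 0`, act on `E(λ, w)` as multiplication by `(α|λ) wᵐ`
(`annihilate_schur`), so the annihilating half of `Y(e^α, ζ)` multiplies `E(λ, w)` by
`(1 - w/ζ) ^ (α|λ)` (`coeff_expPlus_single_schur`), and `e^α_(0) E(λ, w)` is the coefficient of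
`ζ⁻¹` in `E(α, ζ) (1 - w/ζ) ^ (α|λ) E(λ, w)`, times `e^α`. This is `0` for `(α|λ) = 0`, it is
`-w E(λ, w)` for `(α|λ) = 1`, and `w E(α + λ, w)` for `(α|λ) = -1`
(`sum_schur_mul_oneSubPowCoeff`). As `α + λ` is the reflection of `λ` in the last case, the
contributions of `λ` and of its reflection in `α` cancel (`mode_zero_sum_schur`). The same
cancellation takes place after the projection to `h`, because `Fock.map` sends `Sⱼ(λ)` to `Sⱼ` of
the projection of `λ`.

For the existence of lifts, let `C` be the form on `ℂ` with `C(1, 1) = n - |lam|² ≠ 0`, and `L` the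
lattice generated by `Q` and `l = (lam, 1)`. The cocycle on `L` is
`ε(x + a l, y + b l) = εQ(x, y) (-1)^{b (x|l)} (-1)^{a b n (n + 1) / 2}` (`exists_lift`). Simple
roots provide the `ℤ`-basis of `Q` (`exists_basis_rootLattice`).
-/

noncomputable section

namespace LatticeVOA

/-! ### Exponentials of power series over noncommutative algebras -/

section ExpSeries

open PowerSeries Finset

variable {A : Type*} [Ring A] [Algebra ℂ A]

/-- The Euler operator `X d/dX` on formal power series. -/
def euler (f : PowerSeries A) : PowerSeries A :=
  PowerSeries.mk fun n => (n : ℂ) • coeff n f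

@[simp]
theorem coeff_euler (f : PowerSeries A) (n : ℕ) : coeff n (euler f) = (n : ℂ) • coeff n f := by
  simp [euler]

theorem euler_mul (f g : PowerSeries A) : euler (f * g) = euler f * g + f * euler g := by
  ext n
  simp only [coeff_euler, coeff_mul, map_add, smul_sum, ← sum_add_distrib]
  refine sum_congr rfl fun p hp => ?_
  rw [HasAntidiagonal.mem_antidiagonal] at hp
  rw [smul_mul_assoc, mul_smul_comm, ← add_smul, ← hp, Nat.cast_add]

theorem euler_add (f g : PowerSeries A) : euler (f + g) = euler f + euler g := by
  ext n
  simp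

theorem commute_euler {f : PowerSeries A} (hf : ∀ i j, Commute (coeff i f) (coeff j f)) :
    Commute f (euler f) := by
  ext n
  simp only [coeff_mul, coeff_euler]
  rw [← Nat.sum_antidiagonal_swap]
  refine sum_congr rfl fun p _ => ?_
  simp only [Prod.fst_swap, Prod.snd_swap, smul_mul_assoc, mul_smul_comm]
  rw [(hf _ _).eq]

/-- The power rule; it needs `f` to commute with its derivative. -/
theorem euler_pow_succ {f : PowerSeries A} (hf : Commute f (euler f)) (k : ℕ) :
    euler (f ^ (k + 1)) = (k + 1) • (euler f * f ^ k) := by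
  induction k with
  | zero => simp
  | succ k ih =>
    rw [pow_succ, euler_mul, ih, smul_mul_assoc, mul_assoc, ← pow_succ,
      (hf.pow_left (k + 1)).eq, ← succ_nsmul]

theorem coeff_pow_eq_zero_of_lt {A : Type*} [Ring A] {f : PowerSeries A}
    (hf : coeff 0 f = 0) {n k : ℕ} (h : n < k) : coeff n (f ^ k) = 0 := by
  induction k generalizing n with
  | zero => omega
  | succ k ih =>
    rw [pow_succ, coeff_mul]
    refine sum_eq_zero fun p hp => ?_
    rw [HasAntidiagonal.mem_antidiagonal] at hp
    rcases Nat.eq_zero_or_pos p.2 with h0 | h0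
    · rw [h0, hf, mul_zero]
    · rw [ih (by omega), zero_mul]

/-- In the definition of the `n`-th coefficient of `exp f` the sum may be extended to any range
containing `n`. -/
theorem coeff_expSeries {f : PowerSeries A} (hf : coeff 0 f = 0) {n N : ℕ} (h : n < N) :
    coeff n (expSeries f) = ∑ k ∈ range N, ((k.factorial : ℂ)⁻¹) • coeff n (f ^ k) := by
  rw [expSeries, coeff_mk]
  refine sum_subset (range_subset_range.2 h) fun k _ hk => ?_
  rw [mem_range, not_lt] at hk
  rw [coeff_pow_eq_zero_of_lt hf (by omega), smul_zero]

theorem coeff_zero_expSeries (f : PowerSeries A) : coeff 0 (expSeries f) = 1 := by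
  simp [expSeries]

/-- The exponential satisfies the differential equation `(exp f)' = f' exp f`. -/
theorem euler_expSeries {f : PowerSeries A} (h0 : coeff 0 f = 0)
    (hf : ∀ i j, Commute (coeff i f) (coeff j f)) :
    euler (expSeries f) = euler f * expSeries f := by
  ext n
  have h1 : coeff n (euler f * expSeries f) =
      ∑ k ∈ range (n + 1), ((k.factorial : ℂ)⁻¹) • coeff n (euler f * f ^ k) := by
    simp only [coeff_mul, smul_sum]
    rw [sum_comm]
    refine sum_congr rfl fun p hp => ?_
    rw [HasAntidiagonal.mem_antidiagonal] at hp
    rw [coeff_expSeries h0 (show p.2 < n + 1 by omega), mul_sum]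
    simp only [mul_smul_comm]
  rw [h1, coeff_euler, coeff_expSeries h0 (show n < n + 1 + 1 by omega), sum_range_succ', smul_add,
    smul_sum]
  have h2 : (n : ℂ) • ((Nat.factorial 0 : ℂ)⁻¹) • coeff n (f ^ 0) = 0 := by
    rcases Nat.eq_zero_or_pos n with rfl | hn
    · simp
    · simp [coeff_one, hn.ne']
  rw [h2, add_zero]
  refine sum_congr rfl fun k _ => ?_
  rw [smul_comm, ← coeff_euler, euler_pow_succ (commute_euler hf), map_nsmul,
    ← Nat.cast_smul_eq_nsmul ℂ, smul_smul]
  congr 1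
  rw [Nat.factorial_succ]
  push_cast
  field_simp

/-- A power series is determined by its constant term and its logarithmic derivative. -/
theorem eq_of_euler_eq_mul {f g u : PowerSeries A} (hu : coeff 0 u = 0)
    (h0 : coeff 0 f = coeff 0 g) (hf : euler f = u * f) (hg : euler g = u * g) : f = g := by
  ext n
  induction n using Nat.strong_induction_on with
  | _ n ih =>
    rcases Nat.eq_zero_or_pos n with rfl | hn
    · exact h0
    · have h : (n : ℂ) • coeff n f = (n : ℂ) • coeff n g := by
        rw [← coeff_euler, ← coeff_euler, hf, hg, coeff_mul, coeff_mul]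
        refine sum_congr rfl fun p hp => ?_
        rw [HasAntidiagonal.mem_antidiagonal] at hp
        rcases Nat.eq_zero_or_pos p.1 with h1 | h1
        · rw [h1, hu, zero_mul, zero_mul]
        · rw [ih p.2 (by omega)]
      have hn' : (n : ℂ) ≠ 0 := Nat.cast_ne_zero.2 hn.ne'
      simpa [smul_smul, hn'] using congrArg (fun x => (n : ℂ)⁻¹ • x) h

theorem expSeries_add {A : Type*} [CommRing A] [Algebra ℂ A] {f g : PowerSeries A}
    (hf : coeff 0 f = 0) (hg : coeff 0 g = 0) :
    expSeries (f + g) = expSeries f * expSeries g := by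
  refine eq_of_euler_eq_mul (u := euler (f + g)) (by simp) ?_
    (euler_expSeries (by rw [map_add, hf, hg, add_zero]) fun _ _ => Commute.all _ _) ?_
  · rw [coeff_mul]
    simp [coeff_zero_expSeries]
  · rw [euler_mul, euler_expSeries hf fun _ _ => Commute.all _ _,
      euler_expSeries hg fun _ _ => Commute.all _ _, euler_add]
    ring

/-- The exponential commutes with algebra homomorphisms. -/
theorem map_coeff_expSeries {A' : Type*} [Ring A'] [Algebra ℂ A'] (φ : A →ₐ[ℂ] A')
    (f : PowerSeries A) (n : ℕ) :
    φ (coeff n (expSeries f)) = coeff n (expSeries (PowerSeries.map φ.toRingHom f)) := by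
  simp only [expSeries, coeff_mk, map_sum, map_smul, ← map_pow, coeff_map]
  rfl

/-- The recursion `(n + 1) Eₙ₊₁ = ∑ (i + 1) f_{i+1} Eⱼ`, over `i + j = n`, for the coefficients of
`E = exp f`. -/
theorem succ_smul_coeff_expSeries {f : PowerSeries A} (h0 : coeff 0 f = 0)
    (hf : ∀ i j, Commute (coeff i f) (coeff j f)) (n : ℕ) :
    ((n : ℂ) + 1) • coeff (n + 1) (expSeries f) =
      ∑ p ∈ antidiagonal n,
        (((p.1 : ℂ) + 1) • coeff (p.1 + 1) f) * coeff p.2 (expSeries f) := by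
  have key := congrArg (coeff (n + 1)) (euler_expSeries h0 hf)
  rw [coeff_euler, coeff_mul, Nat.cast_succ] at key
  rw [key, Nat.sum_antidiagonal_succ]
  simp

/-- The action of `exp f`, for a power series `f` of commuting operators, on a vector `v 0` is
determined by the recursion for the coefficients of `exp f`. -/
theorem coeff_expSeries_apply {V : Type*} [AddCommGroup V] [Module ℂ V]
    {f : PowerSeries (Module.End ℂ V)} (h0 : coeff 0 f = 0)
    (hf : ∀ i j x, coeff i f (coeff j f x) = coeff j f (coeff i f x)) (v : ℕ → V)
    (hv : ∀ n : ℕ, ((n : ℂ) + 1) • v (n + 1) =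
      ∑ p ∈ antidiagonal n, ((p.1 : ℂ) + 1) • coeff (p.1 + 1) f (v p.2)) (n : ℕ) :
    coeff n (expSeries f) (v 0) = v n := by
  induction n using Nat.strong_induction_on with
  | _ n ih =>
    rcases n with _ | n
    · rw [coeff_zero_expSeries, Module.End.one_apply]
    have hn : ((n : ℂ) + 1) ≠ 0 := Nat.cast_add_one_ne_zero n
    refine smul_right_injective _ hn ?_
    change ((n : ℂ) + 1) • coeff (n + 1) (expSeries f) (v 0) = ((n : ℂ) + 1) • v (n + 1)
    rw [← LinearMap.smul_apply,
      succ_smul_coeff_expSeries h0 (fun i j => LinearMap.ext (hf i j)), LinearMap.sum_apply, hv]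
    refine sum_congr rfl fun p hp => ?_
    rw [HasAntidiagonal.mem_antidiagonal] at hp
    rw [Module.End.mul_apply, ih p.2 (by omega), LinearMap.smul_apply]

end ExpSeries

/-! ### Elementary Schur polynomials in the Fock space -/

section Schur

open Finset

variable {H : Type*} [AddCommGroup H] [Module ℂ H]

theorem gen_add (m : ℕ) (a b : H) : gen m (a + b) = gen m a + gen m b := by
  simp [gen, Finsupp.single_add]

/-- The power series `∑_{m>0} a_{-m} ζᵐ / m` with coefficients in the Fock space. -/
def creationSeries (a : H) : PowerSeries (Fock H) :=
  PowerSeries.mk fun m => if m = 0 then 0 else (m : ℂ)⁻¹ • gen (m - 1) a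

/-- The elementary Schur polynomial in the `a_{-m}`: the coefficient of `ζʲ` in
`exp (∑_{m>0} a_{-m} ζᵐ / m)`. The index is an integer, and the value is zero for `j < 0`. -/
def schur (a : H) (j : ℤ) : Fock H :=
  if 0 ≤ j then PowerSeries.coeff j.toNat (expSeries (creationSeries a)) else 0

theorem coeff_zero_creationSeries (a : H) : PowerSeries.coeff 0 (creationSeries a) = 0 := by
  simp [creationSeries]

theorem succ_smul_coeff_creationSeries (a : H) (m : ℕ) :
    ((m : ℂ) + 1) • PowerSeries.coeff (m + 1) (creationSeries a) = gen m a := by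
  have hm : ((m : ℂ) + 1) ≠ 0 := Nat.cast_add_one_ne_zero m
  simp [creationSeries, smul_smul, hm]

theorem schur_of_neg (a : H) {j : ℤ} (hj : j < 0) : schur a j = 0 :=
  if_neg (not_le.2 hj)

theorem schur_natCast (a : H) (n : ℕ) :
    schur a n = PowerSeries.coeff n (expSeries (creationSeries a)) := by
  simp [schur]

@[simp]
theorem schur_zero (a : H) : schur a 0 = 1 :=
  (schur_natCast a 0).trans (coeff_zero_expSeries _)

/-- The recursion `j Sⱼ = ∑_{m>0} a_{-m} S_{j-m}`. The terms with `m > j` vanish, so the sum may be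
cut off at any `M ≥ j`. -/
theorem smul_schur (a : H) (j : ℤ) {M : ℕ} (h : j ≤ M) :
    (j : ℂ) • schur a j = ∑ m ∈ range M, gen m a * schur a (j - m - 1) := by
  rcases lt_or_ge 0 j with hj | hj
  · obtain ⟨n, rfl⟩ : ∃ n : ℕ, j = (n + 1 : ℕ) := ⟨(j - 1).toNat, by omega⟩
    have key := succ_smul_coeff_expSeries (coeff_zero_creationSeries a)
      (fun _ _ => Commute.all _ _) n
    simp only [succ_smul_coeff_creationSeries] at key
    rw [Nat.sum_antidiagonal_eq_sum_range_succ_mk] at key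
    rw [schur_natCast, Int.cast_natCast, Nat.cast_succ, key]
    have hsub : range (n + 1) ⊆ range M := range_subset_range.2 (by omega)
    rw [← sum_subset hsub]
    · refine sum_congr rfl fun m hm => ?_
      rw [mem_range] at hm
      rw [← schur_natCast]
      congr 2
      omega
    · intro m _ hm
      rw [mem_range] at hm
      rw [schur_of_neg a (by omega), mul_zero]
  · have hl : (j : ℂ) • schur a j = 0 := by
      rcases hj.lt_or_eq with h | rfl
      · rw [schur_of_neg a h, smul_zero]
      · simp
    rw [hl, sum_eq_zero fun m _ => by rw [schur_of_neg a (by omega), mul_zero]]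

/-- The exponentials of `a` and `b` multiply to the exponential of `a + b`. -/
theorem schur_add (a b : H) (j : ℤ) {N : ℕ} (h : j < N) :
    schur (a + b) j = ∑ k ∈ range N, schur a k * schur b (j - k) := by
  rcases lt_or_ge j 0 with hj | hj
  · rw [schur_of_neg _ hj, sum_eq_zero fun k _ => by rw [schur_of_neg b (by omega), mul_zero]]
  · lift j to ℕ using hj
    have hadd : creationSeries (a + b) = creationSeries a + creationSeries b := by
      ext n
      simp only [creationSeries, PowerSeries.coeff_mk, map_add]
      split_ifs <;> simp [gen_add]
    rw [schur_natCast, hadd, expSeries_add (coeff_zero_creationSeries a)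
      (coeff_zero_creationSeries b),
      PowerSeries.coeff_mul, Nat.sum_antidiagonal_eq_sum_range_succ_mk]
    have hsub : range (j + 1) ⊆ range N := range_subset_range.2 (by omega)
    rw [← sum_subset hsub]
    · refine sum_congr rfl fun m hm => ?_
      rw [mem_range] at hm
      rw [← schur_natCast, ← schur_natCast, Nat.cast_sub (by omega)]
    · intro m _ hm
      rw [mem_range] at hm
      rw [schur_of_neg b (by omega), mul_zero]

theorem map_gen {H' : Type*} [AddCommGroup H'] [Module ℂ H'] (f : H →ₗ[ℂ] H') (m : ℕ) (a : H) :
    Fock.map f (gen m a) = gen m (f a) := by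
  simp [Fock.map, gen]

theorem map_schur {H' : Type*} [AddCommGroup H'] [Module ℂ H'] (f : H →ₗ[ℂ] H') (a : H) (j : ℤ) :
    Fock.map f (schur a j) = schur (f a) j := by
  unfold schur
  split_ifs
  · rw [map_coeff_expSeries]
    congr 2
    ext n
    simp only [creationSeries, PowerSeries.coeff_map, PowerSeries.coeff_mk]
    split_ifs
    · simp
    · exact (map_smul (Fock.map f) _ _).trans (by rw [map_gen])
  · simp

end Schur

/-! ### Annihilation operators -/

section Annihilation

open Finset

variable {H : Type*} [AddCommGroup H] [Module ℂ H]

theorem contract_algebraMap (φ : (ℕ →₀ H) →ₗ[ℂ] ℂ) (c : ℂ) :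
    contract φ (algebraMap ℂ (Fock H) c) = 0 := by
  rw [Algebra.algebraMap_eq_smul_one, map_smul, contract_one, smul_zero]

theorem contract_comm (φ ψ : (ℕ →₀ H) →ₗ[ℂ] ℂ) (x : Fock H) :
    contract φ (contract ψ x) = contract ψ (contract φ x) := by
  induction x using SymmetricAlgebra.induction with
  | algebraMap c => simp [contract_algebraMap]
  | ι u => simp [contract_ι, contract_algebraMap]
  | mul x y hx hy =>
    simp only [contract_mul, map_add, hx, hy]
    ring
  | add x y hx hy => simp [hx, hy]

theorem annihilate_one (B : LinearMap.BilinForm ℂ H) (a : H) (m : ℕ) :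
    annihilate B a m 1 = 0 :=
  contract_one _

theorem annihilate_mul (B : LinearMap.BilinForm ℂ H) (a : H) (m : ℕ) (x y : Fock H) :
    annihilate B a m (x * y) = x * annihilate B a m y + y * annihilate B a m x :=
  contract_mul _ _ _

theorem annihilate_gen (B : LinearMap.BilinForm ℂ H) (a b : H) (m k : ℕ) :
    annihilate B a m (gen k b) =
      if k = m then algebraMap ℂ (Fock H) (((m : ℂ) + 1) * B a b) else 0 := by
  rw [annihilate, gen, contract_ι]
  by_cases h : k = m
  · simp [h]
  · simp [h]

/-- The exponential `exp (∑_{m>0} b_{-m} wᵐ / m)` is an eigenvector of `a_{m+1}`, with eigenvalue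
`(a|b) w^{m+1}`. -/
theorem annihilate_schur (B : LinearMap.BilinForm ℂ H) (a b : H) (m : ℕ) (j : ℤ) :
    annihilate B a m (schur b j) = B a b • schur b (j - m - 1) := by
  rcases lt_or_ge j 0 with hj | hj
  · rw [schur_of_neg b hj, schur_of_neg b (by omega), map_zero, smul_zero]
  lift j to ℕ using hj
  induction j using Nat.strong_induction_on with
  | _ j ih =>
    rcases Nat.eq_zero_or_pos j with rfl | hj
    · rw [schur_of_neg b (j := ((0 : ℕ) : ℤ) - m - 1) (by omega), Nat.cast_zero, schur_zero,
        annihilate_one, smul_zero]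
    have ih' : ∀ i : ℤ, i < j → annihilate B a m (schur b i) = B a b • schur b (i - m - 1) := by
      intro i hi
      rcases lt_or_ge i 0 with hi' | hi'
      · rw [schur_of_neg b hi', schur_of_neg b (by omega), map_zero, smul_zero]
      · lift i to ℕ using hi'
        exact ih i (by omega)
    have hj' : ((j : ℤ) : ℂ) ≠ 0 := by exact_mod_cast hj.ne'
    refine smul_right_injective _ hj' ?_
    change ((j : ℤ) : ℂ) • annihilate B a m (schur b j) =
      ((j : ℤ) : ℂ) • (B a b • schur b (j - m - 1))
    -- One range of summation serves the recursions for both `j` and `j - m - 1`, and contains `m`.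
    have hM : (j : ℤ) ≤ ((j + m + 1 : ℕ) : ℤ) := by omega
    rw [← map_smul, smul_schur b j hM, map_sum]
    simp only [annihilate_mul, sum_add_distrib]
    have h1 : ∑ k ∈ range (j + m + 1), gen k b * annihilate B a m (schur b (j - k - 1)) =
        B a b • ((((j - m - 1 : ℤ)) : ℂ) • schur b (j - m - 1)) := by
      rw [smul_schur b (j - m - 1) (M := j + m + 1) (by omega), smul_sum]
      refine sum_congr rfl fun k _ => ?_
      rw [ih' _ (by omega), mul_smul_comm]
      congr 3
      omega
    have h2 : ∑ k ∈ range (j + m + 1), schur b (j - k - 1) * annihilate B a m (gen k b) =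
        (((m : ℂ) + 1) * B a b) • schur b (j - m - 1) := by
      rw [sum_eq_single m]
      · rw [annihilate_gen, if_pos rfl, mul_comm, Algebra.smul_def]
      · intro k _ hk
        rw [annihilate_gen, if_neg hk, mul_zero]
      · intro h
        exact absurd (mem_range.2 (by omega)) h
    rw [h1, h2, smul_smul, smul_smul, ← add_smul]
    congr 1
    push_cast
    ring

end Annihilation

/-! ### The two halves of a vertex operator -/

section VertexOperators

open Finset

variable {H : Type*} [AddCommGroup H] [Module ℂ H] {L : AddSubgroup H}

theorem heis_natCast_succ_single (B : LinearMap.BilinForm ℂ H) (a : H) (m : ℕ) (β : L)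
    (x : Fock H) :
    heis B a ((m + 1 : ℕ) : ℤ) (Finsupp.single β x : VL L) =
      Finsupp.single β (annihilate B a m x) := by
  change Finsupp.mapRange.linearMap (annihilate B a m) _ = _
  simp

theorem heis_neg_natCast_succ_single (B : LinearMap.BilinForm ℂ H) (a : H) (m : ℕ) (β : L)
    (x : Fock H) :
    heis B a (-((m + 1 : ℕ) : ℤ)) (Finsupp.single β x : VL L) =
      Finsupp.single β (gen m a * x) := by
  change Finsupp.mapRange.linearMap (LinearMap.mulLeft ℂ (gen m a)) _ = _
  simp

theorem heis_natCast_succ_comm (B : LinearMap.BilinForm ℂ H) (a : H) (m n : ℕ) (v : VL L) :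
    heis B a ((m + 1 : ℕ) : ℤ) (heis B a ((n + 1 : ℕ) : ℤ) v) =
      heis B a ((n + 1 : ℕ) : ℤ) (heis B a ((m + 1 : ℕ) : ℤ) v) := by
  induction v using Finsupp.induction_linear with
  | zero => simp only [map_zero]
  | add x y hx hy => simp only [map_add, hx, hy]
  | single β x =>
    simp only [heis_natCast_succ_single]
    exact congrArg _ (contract_comm _ _ x)

theorem heis_neg_natCast_succ_comm (B : LinearMap.BilinForm ℂ H) (a : H) (m n : ℕ) (v : VL L) :
    heis B a (-((m + 1 : ℕ) : ℤ)) (heis B a (-((n + 1 : ℕ) : ℤ)) v) =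
      heis B a (-((n + 1 : ℕ) : ℤ)) (heis B a (-((m + 1 : ℕ) : ℤ)) v) := by
  induction v using Finsupp.induction_linear with
  | zero => simp only [map_zero]
  | add x y hx hy => simp only [map_add, hx, hy]
  | single β x => simp only [heis_neg_natCast_succ_single, mul_left_comm]

/-- One half `exp (s ∑_{m>0} hₘ Xᵐ / m)` of a vertex operator, applied to a vector of the component
`e^β`. The sign `s` is `1` for the creating half and `-1` for the annihilating half. -/
theorem coeff_expSeries_mk_single (h : ℕ → Module.End ℂ (VL L)) (s : ℂ)
    (hcomm : ∀ m n v, h (m + 1) (h (n + 1) v) = h (n + 1) (h (m + 1) v))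
    (T : ℕ → Fock H → Fock H) (β : L)
    (hT : ∀ m x, h (m + 1) (Finsupp.single β x) = Finsupp.single β (T m x)) (x : ℕ → Fock H)
    (hx : ∀ n : ℕ, ((n : ℂ) + 1) • x (n + 1) =
      ∑ p ∈ HasAntidiagonal.antidiagonal n, s • T p.1 (x p.2)) (n : ℕ) :
    PowerSeries.coeff n (expSeries (PowerSeries.mk fun m : ℕ =>
      if m = 0 then 0 else (s * (m : ℂ)⁻¹) • h m)) (Finsupp.single β (x 0) : VL L) =
      Finsupp.single β (x n) := by
  refine coeff_expSeries_apply (v := fun n => Finsupp.single β (x n)) (by simp) ?_ ?_ n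
  · intro i j v
    rcases i with _ | i
    · simp
    rcases j with _ | j
    · simp
    simp only [PowerSeries.coeff_mk, if_neg (Nat.succ_ne_zero _), LinearMap.smul_apply, map_smul,
      hcomm i j]
    rw [smul_comm]
  · intro n
    rw [Finsupp.smul_single, hx, ← Finsupp.singleAddHom_apply, map_sum]
    refine sum_congr rfl fun p _ => ?_
    have hp : ((p.1 : ℂ) + 1) ≠ 0 := Nat.cast_add_one_ne_zero p.1
    simp only [PowerSeries.coeff_mk, if_neg (Nat.succ_ne_zero _), LinearMap.smul_apply, hT,
      Finsupp.singleAddHom_apply, Finsupp.smul_single, smul_smul, Nat.cast_succ]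
    congr 2
    field_simp

theorem coeff_expMinus_single (B : LinearMap.BilinForm ℂ H) (α β : L) (x : Fock H) (j : ℕ) :
    PowerSeries.coeff j (expMinus B α) (Finsupp.single β x : VL L) =
      Finsupp.single β (schur (α : H) j * x) := by
  have h := coeff_expSeries_mk_single (fun m : ℕ => heis (L := L) B (α : H) (-(m : ℤ))) 1
    (heis_neg_natCast_succ_comm B _) (fun m x => gen m (α : H) * x) β
    (fun m x => heis_neg_natCast_succ_single B _ m β x) (fun n : ℕ => schur (α : H) n * x)
    (fun n => ?_) j
  · simp only [one_mul, Nat.cast_zero, schur_zero] at h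
    exact h
  · have hn := smul_schur (α : H) (n + 1 : ℕ) (M := n + 1) le_rfl
    rw [Int.cast_natCast, Nat.cast_succ] at hn
    rw [← smul_mul_assoc, hn, Nat.sum_antidiagonal_eq_sum_range_succ_mk, sum_mul]
    refine sum_congr rfl fun m hm => ?_
    rw [mem_range] at hm
    rw [one_smul, mul_assoc]
    congr 3
    omega

/-- The exponential `exp (∑_{n>0} α_n ζ^{-n} / (-n))` multiplies `exp (∑_{m>0} b_{-m} wᵐ / m)` by
`(1 - w/ζ) ^ (α|b)`. The coefficients `q` of this binomial series are given by the recursion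
`hq`, so that no power with a complex exponent is needed. -/
theorem coeff_expPlus_single_schur (B : LinearMap.BilinForm ℂ H) (α β : L) (b : H) (j : ℤ)
    (q : ℕ → ℂ) (hq0 : q 0 = 1)
    (hq : ∀ k : ℕ, ((k : ℂ) + 1) * q (k + 1) = -(B α b * ∑ i ∈ range (k + 1), q i)) (k : ℕ) :
    PowerSeries.coeff k (expPlus B α) (Finsupp.single β (schur b j) : VL L) =
      Finsupp.single β (q k • schur b (j - k)) := by
  have h := coeff_expSeries_mk_single (fun m : ℕ => heis (L := L) B (α : H) (m : ℤ)) (-1)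
    (heis_natCast_succ_comm B _) (fun m x => annihilate B (α : H) m x) β
    (fun m x => heis_natCast_succ_single B _ m β x) (fun n : ℕ => q n • schur b (j - n))
    (fun n => ?_) k
  · simp only [neg_one_mul, Nat.cast_zero, hq0, one_smul, sub_zero] at h
    exact h
  · rw [smul_smul, hq, neg_smul, mul_sum, sum_smul, ← Nat.sum_antidiagonal_swap,
      Nat.sum_antidiagonal_eq_sum_range_succ_mk, ← sum_neg_distrib]
    refine sum_congr rfl fun i hi => ?_
    rw [mem_range] at hi
    simp only [Prod.fst_swap, Prod.snd_swap]
    rw [map_smul, annihilate_schur, neg_one_smul, smul_smul, mul_comm (q i)]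
    congr 3
    omega

theorem mulExp_single (ε : L → L → ℤˣ) (α β : L) (x : Fock H) :
    mulExp ε α (Finsupp.single β x : VL L) =
      Finsupp.single (α + β) (((ε α β : ℤ) : ℂ) • x) := by
  simp [mulExp]

/-- A mode `e^α_(n)` on `x ⊗ e^β`, when `exp (∑_{n>0} α_n ζ^{-n} / (-n))` takes `x` to the
polynomial `∑ yₖ ζ^{-k}`, as a finite sum. -/
theorem mode_single (B : LinearMap.BilinForm ℂ H) (ε : L → L → ℤˣ) (α β : L) (n b : ℤ)
    (hb : B α β = b) (x : Fock H) (y : ℕ → Fock H) (N : ℕ)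
    (hy : ∀ k, PowerSeries.coeff k (expPlus B α) (Finsupp.single β x : VL L) =
      Finsupp.single β (y k))
    (hN : ∀ k, N ≤ k → y k = 0) :
    mode B ε α n (Finsupp.single β x) = Finsupp.single (α + β)
      (((ε α β : ℤ) : ℂ) • ∑ k ∈ range N, schur (α : H) (k - b - n - 1) * y k) := by
  have hcond (j k : ℕ) : ((j : ℂ) - (k : ℂ) + B α β = -(n : ℂ) - 1) ↔
      (j : ℤ) = k - b - n - 1 := by
    rw [hb]
    constructor
    · intro h
      have h' : (j : ℤ) - k + b = -n - 1 := by exact_mod_cast h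
      omega
    · intro h
      have h' : (j : ℤ) - k + b = -n - 1 := by omega
      exact_mod_cast h'
  have hterm (j k : ℕ) : mulExp ε α (PowerSeries.coeff j (expMinus B α)
      (PowerSeries.coeff k (expPlus B α) (Finsupp.single β x))) =
      Finsupp.single (α + β) (((ε α β : ℤ) : ℂ) • (schur (α : H) j * y k)) := by
    rw [hy, coeff_expMinus_single, mulExp_single]
  have hinner (j : ℕ) : (∑ᶠ (k : ℕ) (_ : (j : ℂ) - (k : ℂ) + B α β = -(n : ℂ) - 1),
      mulExp ε α (PowerSeries.coeff j (expMinus B α)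
        (PowerSeries.coeff k (expPlus B α) (Finsupp.single β x)))) =
      ∑ k ∈ range N, if (j : ℤ) = k - b - n - 1 then
        Finsupp.single (α + β) (((ε α β : ℤ) : ℂ) • (schur (α : H) j * y k)) else 0 := by
    simp only [hcond, hterm, finsum_eq_if]
    refine finsum_eq_sum_of_support_subset _ fun k hk => ?_
    rw [Function.mem_support] at hk
    by_contra hk'
    rw [mem_coe, mem_range, not_lt] at hk'
    exact hk (by simp [hN k hk'])
  have hsum : mode B ε α n (Finsupp.single β x) =
      ∑ᶠ j : ℕ, ∑ k ∈ range N, if (j : ℤ) = k - b - n - 1 then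
        Finsupp.single (α + β) (((ε α β : ℤ) : ℂ) • (schur (α : H) j * y k)) else 0 := by
    rw [mode, Finsupp.sum_single_index]
    · exact finsum_congr hinner
    · simp
  rw [hsum, finsum_sum_comm]
  · rw [smul_sum, ← Finsupp.singleAddHom_apply, map_sum]
    refine sum_congr rfl fun k _ => ?_
    rw [Finsupp.singleAddHom_apply, finsum_eq_single _ (k - b - n - 1 : ℤ).toNat]
    · split_ifs with h
      · rw [h]
      · rw [schur_of_neg _ (by omega), zero_mul, smul_zero, Finsupp.single_zero]
    · intro j hj
      rw [if_neg (by omega)]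
  · intro k _
    refine (Set.finite_singleton (k - b - n - 1 : ℤ).toNat).subset fun j hj => ?_
    rw [Function.mem_support] at hj
    by_contra hj'
    rw [Set.mem_singleton_iff] at hj'
    exact hj (if_neg (by omega))

/-- The modes of `e^α` on `e^β`. -/
theorem mode_expVec (B : LinearMap.BilinForm ℂ H) (ε : L → L → ℤˣ) (α β : L) (n b : ℤ)
    (hb : B α β = b) :
    mode B ε α n (expVec β) =
      Finsupp.single (α + β) (((ε α β : ℤ) : ℂ) • schur (α : H) (-b - n - 1)) := by
  refine (mode_single B ε α β n b hb 1 (fun k => if k = 0 then 1 else 0) 1 (fun k => ?_)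
    (fun k hk => if_neg (by omega))).trans (by simp)
  -- The vacuum `1` is `schur 0 0`, with `(α|0) = 0`.
  have h := coeff_expPlus_single_schur B α β 0 0 (fun k => if k = 0 then 1 else 0) (if_pos rfl)
    (by simp) k
  rw [schur_zero] at h
  rw [h]
  congr 1
  rcases k with _ | k <;> simp

end VertexOperators

/-! ### Screening operators -/

section Screening

open Finset

variable {H : Type*} [AddCommGroup H] [Module ℂ H] {L : AddSubgroup H}

/-- The coefficients of the binomial series `(1 - X) ^ c`. -/
def oneSubPowCoeff (c : ℂ) (k : ℕ) : ℂ :=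
  ∏ i ∈ range k, (((i : ℂ) - c) / (i + 1))

theorem succ_mul_oneSubPowCoeff (c : ℂ) (k : ℕ) :
    ((k : ℂ) + 1) * oneSubPowCoeff c (k + 1) =
      -(c * ∑ i ∈ range (k + 1), oneSubPowCoeff c i) := by
  have h (k : ℕ) : ((k : ℂ) + 1) * oneSubPowCoeff c (k + 1) = (k - c) * oneSubPowCoeff c k := by
    have hk : ((k : ℂ) + 1) ≠ 0 := Nat.cast_add_one_ne_zero k
    rw [oneSubPowCoeff, prod_range_succ, ← oneSubPowCoeff]
    field_simp
  induction k with
  | zero => simp [oneSubPowCoeff]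
  | succ k ih =>
    rw [h, sum_range_succ, mul_add, neg_add, ← ih]
    push_cast
    ring

theorem oneSubPowCoeff_zero_succ (k : ℕ) : oneSubPowCoeff 0 (k + 1) = 0 :=
  prod_eq_zero (mem_range.2 k.succ_pos) (by simp)

theorem oneSubPowCoeff_one_add_two (k : ℕ) : oneSubPowCoeff 1 (k + 2) = 0 :=
  prod_eq_zero (mem_range.2 (show 1 < k + 2 by omega)) (by simp)

theorem oneSubPowCoeff_neg_one (k : ℕ) : oneSubPowCoeff (-1) k = 1 :=
  prod_eq_one fun i _ => by
    rw [sub_neg_eq_add]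
    exact div_self (Nat.cast_add_one_ne_zero i)

/-- The coefficient of `ζ⁻¹` in `exp (∑ a_{-m} ζᵐ / m) (1 - w/ζ)ᶜ exp (∑ b_{-m} wᵐ / m)`, up to
the power of `w`. For `c = -1` the pole at `ζ = w` substitutes `w` for `ζ`. -/
theorem sum_schur_mul_oneSubPowCoeff (a b : H) (c : ℂ) (hc : c ∈ ({0, 1, -1} : Set ℂ)) (J : ℤ) :
    ∑ k ∈ range (J.toNat + 2), schur a (k - 1) * (oneSubPowCoeff c k • schur b (J - k)) =
      if c = 1 then -schur b (J - 1) else if c = -1 then schur (a + b) (J - 1) else 0 := by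
  rw [sum_range_succ', Nat.cast_zero, schur_of_neg a (j := 0 - 1) (by omega), zero_mul, add_zero]
  rcases hc with rfl | rfl | rfl
  · rw [if_neg (by norm_num), if_neg (by norm_num)]
    refine sum_eq_zero fun k _ => ?_
    rw [oneSubPowCoeff_zero_succ, zero_smul, mul_zero]
  · rw [if_pos rfl, sum_range_succ', sum_eq_zero fun k _ => by
      rw [oneSubPowCoeff_one_add_two, zero_smul, mul_zero]]
    simp [oneSubPowCoeff]
  · rw [if_neg (by norm_num), if_pos rfl, schur_add a b (J - 1) (N := J.toNat + 1) (by omega)]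
    refine sum_congr rfl fun k _ => ?_
    rw [oneSubPowCoeff_neg_one, one_smul]
    congr 2 <;> push_cast <;> ring

/-- The screening operator of a root `α` kills the sum of the vectors `schur l J` over a set that
is stable under the reflection in `α` and whose elements pair with `α` to `0` or `±1`: the
contribution of every `l` cancels that of its reflection. -/
theorem mode_zero_sum_schur (B : LinearMap.BilinForm ℂ H) (ε : L → L → ℤˣ) (α : L)
    (hα : B α α = 2) (O : Finset H) (hO : ∀ l ∈ O, B α l ∈ ({0, 1, -1} : Set ℂ))
    (hs : ∀ l ∈ O, l - B α l • (α : H) ∈ O) (s : ℂ) (J : ℤ) :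
    mode B ε α 0 (Finsupp.single 0 (s • ∑ l ∈ O, schur l J)) = 0 := by
  have hα0 : (α : H) ≠ 0 := by
    intro h
    rw [h, map_zero] at hα
    norm_num at hα
  rw [mode_single B ε α 0 0 0 (by simp) _
    (fun k => s • ∑ l ∈ O, oneSubPowCoeff (B α l) k • schur l (J - k)) (J.toNat + 2)]
  · have hzero : ∑ k ∈ range (J.toNat + 2), schur (α : H) (k - 0 - 0 - 1) *
        (s • ∑ l ∈ O, oneSubPowCoeff (B α l) k • schur l (J - k)) = 0 := by
      simp only [sub_zero, mul_smul_comm, ← smul_sum, mul_sum]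
      simp only [← mul_smul_comm]
      rw [sum_comm, sum_congr rfl fun l hl => sum_schur_mul_oneSubPowCoeff _ _ _ (hO l hl) J]
      have hneg (l : H) : B α (l - B α l • (α : H)) = -B α l := by
        rw [map_sub, map_smul, hα, smul_eq_mul]
        ring
      -- The reflection changes the sign of `(α|l)`, hence exchanges the last two cases of
      -- `sum_schur_mul_oneSubPowCoeff`, and it has no fixed points among them.
      rw [sum_involution (fun l _ => l - B α l • (α : H)), smul_zero]
      · intro l hl
        simp only [hneg]
        rcases hO l hl with h | h | h
        · rw [h]
          norm_num
        · rw [h]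
          norm_num
        · rw [Set.mem_singleton_iff] at h
          rw [h]
          norm_num [add_comm]
      · intro l hl hne heq
        rw [sub_eq_self, smul_eq_zero_iff_left hα0] at heq
        rw [heq] at hne
        norm_num at hne
      · exact hs
      · intro l hl
        simp only [hneg, neg_smul, sub_neg_eq_add, sub_add_cancel]
    rw [hzero, smul_zero, Finsupp.single_zero]
  · intro k
    have hsing (β : L) (f : H → Fock H) : (Finsupp.single β (s • ∑ l ∈ O, f l) : VL L) =
        s • ∑ l ∈ O, Finsupp.single β (f l) := by
      rw [← Finsupp.smul_single, ← Finsupp.singleAddHom_apply, map_sum]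
      rfl
    rw [hsing, hsing, map_smul, map_sum]
    refine congrArg _ (sum_congr rfl fun l _ => ?_)
    exact coeff_expPlus_single_schur B α 0 l J _ (by simp [oneSubPowCoeff])
      (succ_mul_oneSubPowCoeff _) k
  · intro k hk
    rw [sum_eq_zero fun l _ => by rw [schur_of_neg l (by omega), smul_zero], smul_zero]

end Screening

/-! ### Lattices generated by a lift -/

section Lift

variable {h : Type*} [AddCommGroup h] [Module ℂ h]

theorem prodForm_apply {K : Type*} [AddCommGroup K] [Module ℂ K] (B : LinearMap.BilinForm ℂ h)
    (C : LinearMap.BilinForm ℂ K) (u v : h × K) :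
    prodForm B C u v = B u.1 v.1 + C u.2 v.2 :=
  rfl

theorem nondegenerate_prodForm {K : Type*} [AddCommGroup K] [Module ℂ K]
    {B : LinearMap.BilinForm ℂ h} {C : LinearMap.BilinForm ℂ K} (hB : B.Nondegenerate)
    (hC : C.Nondegenerate) : (prodForm B C).Nondegenerate := by
  refine ⟨fun u hu => ?_, fun u hu => ?_⟩
  · refine Prod.ext (hB.1 _ fun x => ?_) (hC.1 _ fun x => ?_)
    · simpa [prodForm_apply] using hu (x, 0)
    · simpa [prodForm_apply] using hu (0, x)
  · refine Prod.ext (hB.2 _ fun x => ?_) (hC.2 _ fun x => ?_)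
    · simpa [prodForm_apply] using hu (x, 0)
    · simpa [prodForm_apply] using hu (0, x)

/-- The embedding `(x, a) ↦ (x + a lam, a)` of `Q ⊕ ℤ` into `h ⊕ ℂ`. Its range is the lattice
generated by `Q` and the lift `(lam, 1)` of `lam`. -/
def liftHom (Q : AddSubgroup h) (lam : h) : Q × ℤ →+ h × ℂ where
  toFun p := ((p.1 : h) + (p.2 : ℂ) • lam, (p.2 : ℂ))
  map_zero' := by simp
  map_add' p q := by
    simp only [Prod.fst_add, Prod.snd_add, AddSubgroup.coe_add, Int.cast_add, add_smul,
      Prod.mk_add_mk]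
    congr 1
    abel

theorem liftHom_apply (Q : AddSubgroup h) (lam : h) (p : Q × ℤ) :
    liftHom Q lam p = ((p.1 : h) + (p.2 : ℂ) • lam, (p.2 : ℂ)) :=
  rfl

theorem liftHom_injective (Q : AddSubgroup h) (lam : h) :
    Function.Injective (liftHom Q lam) := by
  intro p q hpq
  simp only [liftHom_apply, Prod.mk.injEq, Int.cast_inj] at hpq
  obtain ⟨h1, h2⟩ := hpq
  rw [h2] at h1
  exact Prod.ext (Subtype.ext (add_right_cancel h1)) h2

/-- The linear automorphism `(x, t) ↦ (x + t lam, t)` of `h ⊕ ℂ`. -/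
def shear (lam : h) : (h × ℂ) ≃ₗ[ℂ] (h × ℂ) where
  toFun v := (v.1 + v.2 • lam, v.2)
  invFun v := (v.1 - v.2 • lam, v.2)
  left_inv v := by simp
  right_inv v := by simp
  map_add' u v := by
    simp only [Prod.fst_add, Prod.snd_add, add_smul, Prod.mk_add_mk]
    congr 1
    abel
  map_smul' c v := by simp [mul_smul]

theorem shear_apply (lam : h) (v : h × ℂ) : shear lam v = (v.1 + v.2 • lam, v.2) :=
  rfl

/-- A `ℤ`-basis of `Q` and `(lam, 1)` form a `ℤ`-basis of the range of `liftHom`. -/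
theorem exists_basis_range_liftHom (Q : AddSubgroup h) (lam : h)
    (hQ : ∃ (n : ℕ) (b : Module.Basis (Fin n) ℂ h), Q = AddSubgroup.closure (Set.range b)) :
    ∃ (n : ℕ) (b : Module.Basis (Fin n) ℂ (h × ℂ)),
      (liftHom Q lam).range = AddSubgroup.closure (Set.range b) := by
  obtain ⟨n, b, hb⟩ := hQ
  let b₀ : Module.Basis (Fin n ⊕ Fin 1) ℂ (h × ℂ) :=
    (b.prod (Module.Basis.singleton (Fin 1) ℂ)).map (shear lam)
  have hinl (i : Fin n) : b₀ (Sum.inl i) = (b i, 0) := by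
    simp [b₀, shear_apply]
  have hinr (i : Fin 1) : b₀ (Sum.inr i) = (lam, 1) := by
    simp [b₀, shear_apply]
  refine ⟨n + 1, b₀.reindex finSumFinEquiv, ?_⟩
  rw [Module.Basis.range_reindex]
  refine le_antisymm ?_ ((AddSubgroup.closure_le _).2 ?_)
  · rintro _ ⟨⟨⟨x, hx⟩, a⟩, rfl⟩
    have h1 : ((x, 0) : h × ℂ) ∈ AddSubgroup.closure (Set.range b₀) := by
      have hle : Q ≤ (AddSubgroup.closure (Set.range b₀)).comap (AddMonoidHom.inl h ℂ) := by
        rw [hb, AddSubgroup.closure_le]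
        rintro _ ⟨i, rfl⟩
        exact AddSubgroup.subset_closure ⟨Sum.inl i, hinl i⟩
      exact hle hx
    have h2 : ((lam, 1) : h × ℂ) ∈ AddSubgroup.closure (Set.range b₀) :=
      AddSubgroup.subset_closure ⟨Sum.inr 0, hinr 0⟩
    have h3 : liftHom Q lam (⟨x, hx⟩, a) = (x, 0) + a • (lam, (1 : ℂ)) := by
      rw [liftHom_apply, ← Int.cast_smul_eq_zsmul ℂ]
      simp
    rw [h3]
    exact add_mem h1 (zsmul_mem h2 a)
  · rintro _ ⟨i | i, rfl⟩
    · have hi : b i ∈ Q := hb ▸ AddSubgroup.subset_closure ⟨i, rfl⟩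
      exact ⟨(⟨b i, hi⟩, 0), by rw [hinl, liftHom_apply]; simp⟩
    · exact ⟨(0, 1), by rw [hinr, liftHom_apply]; simp⟩

/-- Modulo `2`, the quadratic function `N (N + 1) / 2` at `N = 2 k + 2 a m + a² n`, the norm of
`x + a l` for `|x|² = 2 k`, `(x|l) = m` and `|l|² = n`. -/
theorem neg_one_zpow_norm (k a m n : ℤ) :
    (-1 : ℤˣ) ^ ((2 * k + 2 * (a * m) + a * a * n) * (2 * k + 2 * (a * m) + a * a * n + 1) / 2) =
      (-1) ^ (2 * k * (2 * k + 1) / 2) * (-1) ^ (m * a) *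
        ((-1 : ℤˣ) ^ (n * (n + 1) / 2)) ^ (a * a) := by
  obtain ⟨t, ht⟩ : ∃ t, n * (n + 1) = 2 * t := (Int.even_mul_succ_self n).two_dvd
  obtain ⟨w, hw⟩ : ∃ w, a * a * (a * a - 1) = 4 * w := by
    rcases Int.even_or_odd' a with ⟨c, rfl | rfl⟩
    · exact ⟨c * c * (4 * (c * c) - 1), by ring⟩
    · exact ⟨(2 * c + 1) * (2 * c + 1) * (c * c + c), by ring⟩
  have h1 : 2 * k * (2 * k + 1) / 2 = k * (2 * k + 1) := by
    rw [mul_assoc, Int.mul_ediv_cancel_left _ two_ne_zero]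
  have h2 : (2 * k + 2 * (a * m) + a * a * n) * (2 * k + 2 * (a * m) + a * a * n + 1) / 2 =
      k * (2 * k + 1) + m * a + t * (a * a) + 2 * (n * n * w + 2 * k * (a * m) + a * m * (a * m) +
        (k + a * m) * (a * a * n)) := by
    refine Int.ediv_eq_of_eq_mul_right two_ne_zero ?_
    linear_combination (a * a) * ht + (n * n) * hw
  rw [h1, h2, ht, Int.mul_ediv_cancel_left _ two_ne_zero, ← zpow_mul, zpow_add _ _ (2 * _),
    zpow_mul _ 2]
  simp [zpow_add]

/-- An even lattice `Q` with a cocycle, and a vector `lam` that pairs integrally with `Q`: in the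
lattice generated by `Q` and a lift `l` of `lam` with norm `n`, the formula
`ε(x + a l, y + b l) = εQ(x, y) (-1)^{b (x|l)} (-1)^{a b n (n + 1) / 2}` defines a cocycle. -/
theorem exists_lift {B : LinearMap.BilinForm ℂ h} {Q : AddSubgroup h} (hQ : IsIntegralLattice B Q)
    (heven : ∀ x ∈ Q, ∃ k : ℤ, B x x = 2 * k) {εQ : Q → Q → ℤˣ} (hεQ : IsCocycle B Q εQ)
    {lam : h} (hlam : ∀ x ∈ Q, ∃ m : ℤ, B x lam = m) {n : ℤ} (hn : (n : ℂ) ≠ B lam lam) :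
    ∃ (C : LinearMap.BilinForm ℂ ℂ) (L : AddSubgroup (h × ℂ)) (ε : L → L → ℤˣ) (κ : ℂ),
      IsLatticeExtension B Q εQ C L ε ∧
      (lam, κ) ∈ L ∧ prodForm B C (lam, κ) (lam, κ) = n := by
  choose m hm using fun x : Q => hlam x x.2
  have hm_add (x y : Q) : m (x + y) = m x + m y := by
    have : ((m (x + y) : ℤ) : ℂ) = ((m x + m y : ℤ) : ℂ) := by
      rw [← hm, Int.cast_add, ← hm, ← hm]
      simp
    exact_mod_cast this
  have hm_zero : m 0 = 0 := by
    simpa using hm_add 0 0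
  set c : ℂ := n - B lam lam with hc
  have hc0 : c ≠ 0 := sub_ne_zero.2 hn
  let C : LinearMap.BilinForm ℂ ℂ := c • LinearMap.mul ℂ ℂ
  have hC (z w : ℂ) : C z w = c * (z * w) := rfl
  let f := liftHom Q lam
  let e : Q × ℤ ≃+ f.range := AddMonoidHom.ofInjective (liftHom_injective Q lam)
  have he (p : Q × ℤ) : (e p : h × ℂ) = ((p.1 : h) + (p.2 : ℂ) • lam, (p.2 : ℂ)) := rfl
  let ε₀ : Q × ℤ → Q × ℤ → ℤˣ := fun p q =>
    εQ p.1 q.1 * (-1) ^ (m p.1 * q.2) * ((-1) ^ (n * (n + 1) / 2)) ^ (p.2 * q.2)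
  let ε : f.range → f.range → ℤˣ := fun u v => ε₀ (e.symm u) (e.symm v)
  have hform (p q : Q × ℤ) : prodForm B C (e p : h × ℂ) (e q : h × ℂ) =
      B p.1 q.1 + m p.1 * q.2 + m q.1 * p.2 + p.2 * q.2 * n := by
    rw [prodForm_apply, he, he, hC]
    simp only [map_add, map_smul, LinearMap.add_apply, LinearMap.smul_apply, smul_eq_mul]
    rw [hm, hQ.symm.eq lam, hm, hc]
    ring
  have hincl (x : Q) : e (x, 0) = ⟨((x : h), 0), ⟨(x, 0), by simp [f, liftHom_apply]⟩⟩ :=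
    Subtype.ext (by simp [he])
  have hlat : IsIntegralLattice (prodForm B C) f.range := by
    refine ⟨⟨fun u v => ?_⟩,
      nondegenerate_prodForm hQ.nondegenerate ⟨fun z hz => ?_, fun z hz => ?_⟩,
      exists_basis_range_liftHom Q lam hQ.basis, ?_⟩
    · rw [prodForm_apply, prodForm_apply, hQ.symm.eq, hC, hC, mul_comm u.2]
    · simpa [hC, hc0] using hz 1
    · simpa [hC, hc0] using hz 1
    · rintro _ ⟨p, rfl⟩ _ ⟨q, rfl⟩
      obtain ⟨k, hk⟩ := hQ.integral _ p.1.2 _ q.1.2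
      refine ⟨k + m p.1 * q.2 + m q.1 * p.2 + p.2 * q.2 * n, ?_⟩
      refine (hform p q).trans ?_
      rw [hk]
      push_cast
      ring
  have hcoc : IsCocycle (prodForm B C) f.range ε := by
    refine ⟨fun x y z => ?_, fun x y z => ?_, fun x N hN => ?_⟩
    · simp only [ε, ε₀, map_add, Prod.fst_add, Prod.snd_add, hεQ.add_left, hm_add, add_mul,
        zpow_add]
      ac_rfl
    · simp only [ε, ε₀, map_add, Prod.fst_add, Prod.snd_add, hεQ.add_right, mul_add, zpow_add]
      ac_rfl
    · obtain ⟨⟨y, a⟩, rfl⟩ := e.surjective x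
      obtain ⟨k, hk⟩ := heven y y.2
      rw [hform, hk] at hN
      have hN' : N = 2 * k + 2 * (a * m y) + a * a * n := by
        have : ((2 * k + 2 * (a * m y) + a * a * n : ℤ) : ℂ) = (N : ℂ) := by
          rw [← hN]
          push_cast
          ring
        exact_mod_cast this.symm
      rw [hN', neg_one_zpow_norm]
      simp only [ε, ε₀, AddEquiv.symm_apply_apply]
      rw [hεQ.diag y (2 * k) (by rw [hk]; push_cast; ring)]
  refine ⟨C, f.range, ε, 1, ⟨hlat, hcoc, fun x => ⟨(x, 0), by simp [f, liftHom_apply]⟩,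
    fun x y => ?_⟩, ⟨(0, 1), by simp [f, liftHom_apply]⟩, ?_⟩
  · rw [← hincl, ← hincl]
    simp [ε, ε₀]
  · rw [prodForm_apply, hC, hc]
    simp

end Lift

/-! ### Root lattices and orbits of the Weyl group -/

section Weyl

variable {ι h N : Type*} [AddCommGroup h] [Module ℂ h] [AddCommGroup N] [Module ℂ N]
  {P : RootPairing ι ℂ h N} {B : LinearMap.BilinForm ℂ h}

/-- For an invariant form normalized by `(α|α) = 2`, the coroot of `α` is the functional
`(·|α)`. -/
theorem form_root (hinv : ∀ i x y, B (P.reflection i x) (P.reflection i y) = B x y)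
    (hnorm : ∀ i, B (P.root i) (P.root i) = 2) (i : ι) (x : h) :
    B x (P.root i) = P.coroot' i x := by
  have h1 := hinv i x (P.root i)
  rw [P.reflection_apply_self, P.reflection_apply] at h1
  simp only [map_neg, map_sub, map_smul, LinearMap.sub_apply, LinearMap.smul_apply, hnorm,
    smul_eq_mul] at h1
  linear_combination -(1 / 2 : ℂ) * h1

theorem reflection_eq_sub (hinv : ∀ i x y, B (P.reflection i x) (P.reflection i y) = B x y)
    (hnorm : ∀ i, B (P.root i) (P.root i) = 2) (i : ι) (x : h) :
    P.reflection i x = x - B x (P.root i) • P.root i := by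
  rw [P.reflection_apply, form_root hinv hnorm]

theorem eq_zero_of_form_root_eq_zero [P.IsRootSystem]
    (hinv : ∀ i x y, B (P.reflection i x) (P.reflection i y) = B x y)
    (hnorm : ∀ i, B (P.root i) (P.root i) = 2) {x : h} (hx : ∀ i, B x (P.root i) = 0) :
    x = 0 := by
  have h1 : P.toLinearMap x = 0 := by
    refine LinearMap.ext_on_range (v := P.coroot)
      (RootPairing.IsRootSystem.span_coroot_eq_top (P := P)) fun i => ?_
    have := hx i
    rwa [form_root hinv hnorm] at this
  exact P.toLinearMap.toPerfPair.injective (h1.trans (map_zero P.toLinearMap.toPerfPair).symm)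

theorem integral_of_rootLattice {x : h} (hx : ∀ i, ∃ n : ℤ, B x (P.root i) = n) {y : h}
    (hy : y ∈ rootLattice P) : ∃ n : ℤ, B x y = n := by
  induction hy using AddSubgroup.closure_induction with
  | mem y hy =>
    obtain ⟨i, rfl⟩ := hy
    exact hx i
  | zero => exact ⟨0, by simp⟩
  | add y z _ _ hy hz =>
    obtain ⟨a, ha⟩ := hy
    obtain ⟨b, hb⟩ := hz
    exact ⟨a + b, by simp [ha, hb]⟩
  | neg y _ hy =>
    obtain ⟨a, ha⟩ := hy
    exact ⟨-a, by simp [ha]⟩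

theorem rootLattice_integral [P.IsCrystallographic] (hsymm : B.IsSymm)
    (hinv : ∀ i x y, B (P.reflection i x) (P.reflection i y) = B x y)
    (hnorm : ∀ i, B (P.root i) (P.root i) = 2) {x y : h} (hx : x ∈ rootLattice P)
    (hy : y ∈ rootLattice P) : ∃ n : ℤ, B x y = n := by
  refine integral_of_rootLattice (fun i => ?_) hy
  rw [hsymm.eq]
  refine integral_of_rootLattice (fun j => ?_) hx
  obtain ⟨n, hn⟩ := P.exists_value (S := ℤ) i j
  rw [form_root hinv hnorm]
  exact ⟨n, by simpa using hn.symm⟩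

theorem rootLattice_even [P.IsCrystallographic] (hsymm : B.IsSymm)
    (hinv : ∀ i x y, B (P.reflection i x) (P.reflection i y) = B x y)
    (hnorm : ∀ i, B (P.root i) (P.root i) = 2) {x : h} (hx : x ∈ rootLattice P) :
    ∃ k : ℤ, B x x = 2 * k := by
  induction hx using AddSubgroup.closure_induction with
  | mem x hx =>
    obtain ⟨i, rfl⟩ := hx
    exact ⟨1, by simp [hnorm]⟩
  | zero => exact ⟨0, by simp⟩
  | add x y hx hy ihx ihy =>
    obtain ⟨a, ha⟩ := ihx
    obtain ⟨b, hb⟩ := ihy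
    obtain ⟨c, hc⟩ := rootLattice_integral hsymm hinv hnorm hx hy
    refine ⟨a + b + c, ?_⟩
    simp only [map_add, LinearMap.add_apply, ha, hb, hsymm.eq y x, hc]
    push_cast
    ring
  | neg x hx ih =>
    obtain ⟨a, ha⟩ := ih
    exact ⟨a, by simp [ha]⟩

/-- Simple roots form a `ℤ`-basis of the root lattice. -/
theorem exists_basis_rootLattice [Finite ι] (P : RootPairing ι ℂ h N) [P.IsRootSystem]
    [P.IsCrystallographic] [P.IsReduced] :
    ∃ (n : ℕ) (b : Module.Basis (Fin n) ℂ h),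
      rootLattice P = AddSubgroup.closure (Set.range b) := by
  obtain ⟨b⟩ := P.nonempty_base
  refine ⟨_, b.toWeightBasis.reindex (Fintype.equivFin b.support), ?_⟩
  rw [Module.Basis.range_reindex]
  have hrange : Set.range b.toWeightBasis = P.root '' b.support := by
    ext x
    simp
  have hspan := congrArg Submodule.toAddSubgroup b.span_int_root_support
  rw [Submodule.span_int_eq_addSubgroupClosure, Submodule.span_int_eq_addSubgroupClosure] at hspan
  rw [hrange]
  exact hspan.symm

theorem isIntegralLattice_rootLattice [Finite ι] [P.IsRootSystem] [P.IsCrystallographic]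
    [P.IsReduced] (hsymm : B.IsSymm)
    (hinv : ∀ i x y, B (P.reflection i x) (P.reflection i y) = B x y)
    (hnorm : ∀ i, B (P.root i) (P.root i) = 2) : IsIntegralLattice B (rootLattice P) where
  symm := hsymm
  nondegenerate :=
    ⟨fun _ hx => eq_zero_of_form_root_eq_zero hinv hnorm fun _ => hx _,
      fun _ hx => eq_zero_of_form_root_eq_zero hinv hnorm fun _ => (hsymm.eq _ _).trans (hx _)⟩
  basis := exists_basis_rootLattice P
  integral _ hx _ hy := rootLattice_integral hsymm hinv hnorm hx hy

/-- A property that is stable under the reflections holds on the whole Weyl group orbit. -/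
theorem orbit_weylGroup_induction {p : h → Prop} {x y : h} (hx : p x)
    (hp : ∀ i z, p z → p (P.reflection i z)) (hy : y ∈ MulAction.orbit P.weylGroup x) : p y := by
  obtain ⟨⟨w, hw⟩, rfl⟩ := hy
  have key : ∀ z, p z → p (w • z) := by
    induction hw using RootPairing.weylGroup.induction with
    | mem i => exact fun z hz => hp i z hz
    | one => exact fun z hz => by rwa [one_smul]
    | mul u v _ _ hu hv =>
      intro z hz
      rw [mul_smul]
      exact hu _ (hv z hz)
  exact key x hx

theorem reflection_mem_orbit {x y : h} (i : ι) (hy : y ∈ MulAction.orbit P.weylGroup x) :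
    P.reflection i y ∈ MulAction.orbit P.weylGroup x :=
  MulAction.mem_orbit_of_mem_orbit (RootPairing.weylGroup.ofIdx P i) hy

theorem form_root_mem_of_mem_orbit
    (hinv : ∀ i x y, B (P.reflection i x) (P.reflection i y) = B x y) {S : Set ℂ} {lam y : h}
    (hlam : ∀ i, B lam (P.root i) ∈ S) (hy : y ∈ MulAction.orbit P.weylGroup lam) (i : ι) :
    B y (P.root i) ∈ S := by
  refine orbit_weylGroup_induction (p := fun y => ∀ i, B y (P.root i) ∈ S) hlam ?_ hy i
  intro j z hz i
  rw [← hinv j, P.reflection_same, ← P.root_reflectionPerm]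
  exact hz _

theorem form_self_of_mem_orbit
    (hinv : ∀ i x y, B (P.reflection i x) (P.reflection i y) = B x y) {lam y : h}
    (hy : y ∈ MulAction.orbit P.weylGroup lam) : B y y = B lam lam :=
  orbit_weylGroup_induction (p := fun y => B y y = B lam lam) rfl
    (fun _ _ hz => (hinv _ _ _).trans hz) hy

theorem sub_mem_rootLattice_of_mem_orbit
    (hinv : ∀ i x y, B (P.reflection i x) (P.reflection i y) = B x y)
    (hnorm : ∀ i, B (P.root i) (P.root i) = 2) {lam y : h}
    (hlam : ∀ i, ∃ n : ℤ, B lam (P.root i) = n)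
    (hy : y ∈ MulAction.orbit P.weylGroup lam) : y - lam ∈ rootLattice P := by
  refine (orbit_weylGroup_induction (p := fun y => y ∈ MulAction.orbit P.weylGroup lam ∧
    y - lam ∈ rootLattice P) ⟨MulAction.mem_orbit_self lam, by simp [zero_mem]⟩
    ?_ hy).2
  rintro i z ⟨hz, hz'⟩
  refine ⟨reflection_mem_orbit i hz, ?_⟩
  obtain ⟨n, hn⟩ := form_root_mem_of_mem_orbit hinv (S := {c | ∃ n : ℤ, c = n}) hlam hz i
  rw [reflection_eq_sub hinv hnorm, hn, Int.cast_smul_eq_zsmul, sub_right_comm]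
  exact sub_mem hz' (zsmul_mem (AddSubgroup.subset_closure (Set.mem_range_self i)) n)

/-- A vector is determined by its pairings with the roots, and along the orbit these take
finitely many values. -/
theorem finite_orbit_weylGroup [Finite ι] [P.IsRootSystem]
    (hinv : ∀ i x y, B (P.reflection i x) (P.reflection i y) = B x y)
    (hnorm : ∀ i, B (P.root i) (P.root i) = 2) {S : Set ℂ} (hS : S.Finite) {lam : h}
    (hlam : ∀ i, B lam (P.root i) ∈ S) : (MulAction.orbit P.weylGroup lam).Finite := by
  refine Set.Finite.of_injOn (f := fun x i => B x (P.root i)) (t := Set.univ.pi fun _ : ι => S)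
    (fun _ hx _ _ => form_root_mem_of_mem_orbit hinv hlam hx _) (fun x _ y _ hxy => ?_)
    (Set.Finite.pi fun _ => hS)
  refine sub_eq_zero.1 (eq_zero_of_form_root_eq_zero hinv hnorm fun i => ?_)
  rw [map_sub, LinearMap.sub_apply, sub_eq_zero]
  exact congrFun hxy i

end Weyl

/-! ### The sum over an orbit -/

section Nu

variable {ι h N K : Type*} [AddCommGroup h] [Module ℂ h] [AddCommGroup N] [Module ℂ N]
  [AddCommGroup K] [Module ℂ K] {P : RootPairing ι ℂ h N} {B : LinearMap.BilinForm ℂ h}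

theorem IsCocycle.apply_neg_right {H : Type*} [AddCommGroup H] [Module ℂ H]
    {B : LinearMap.BilinForm ℂ H} {L : AddSubgroup H} {ε : L → L → ℤˣ} (hε : IsCocycle B L ε)
    (x y : L) : ε x (-y) = (ε x y)⁻¹ := by
  have h0 : ε x 0 = 1 := by
    have := hε.add_right x 0 0
    rwa [add_zero, left_eq_mul] at this
  rw [← mul_eq_one_iff_eq_inv, ← hε.add_right, neg_add_cancel, h0]

/-- All elements of the orbit of `(lam, κ)` have the same norm `M`, so that the terms of `nu` are
Schur polynomials of the same index `M + d - 1`, with the same sign. -/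
theorem nu_eq {C : LinearMap.BilinForm ℂ K} {L : AddSubgroup (h × K)} {ε : L → L → ℤˣ}
    (hε : IsCocycle (prodForm B C) L ε) {lam : h} {κ : K} {M : ℤ}
    (hM : B lam lam + C κ κ = M)
    (hinv : ∀ i x y, B (P.reflection i x) (P.reflection i y) = B x y)
    (hL : ∀ x ∈ MulAction.orbit P.weylGroup lam, (x, κ) ∈ L)
    (hfin : (MulAction.orbit P.weylGroup lam).Finite) (d : ℕ) :
    nu P B C L ε lam κ d = Finsupp.single 0 
      ((((((-1) ^ (M * (M + 1) / 2) : ℤˣ)⁻¹ : ℤˣ) : ℤ) : ℂ) •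
      ∑ x ∈ hfin.toFinset, schur (x, κ) (M + d - 1)) := by
  set s : ℂ := (((((-1) ^ (M * (M + 1) / 2) : ℤˣ)⁻¹ : ℤˣ) : ℤ) : ℂ)
  have hterm (l : L) (hl : (l : h × K).1 ∈ MulAction.orbit P.weylGroup lam ∧
      (l : h × K).2 = κ) : mode (prodForm B C) ε l (-(d : ℤ)) (expVec (-l)) =
      Finsupp.single 0 (s • schur ((l : h × K).1, κ) (M + d - 1)) := by
    have hnorm : prodForm B C (l : h × K) (l : h × K) = M := by
      rw [prodForm_apply, hl.2, form_self_of_mem_orbit hinv hl.1, hM]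
    have hneg : prodForm B C (l : h × K) ((-l : L) : h × K) = ((-M : ℤ) : ℂ) := by
      rw [AddSubgroup.coe_neg, map_neg, hnorm, Int.cast_neg]
    have hl' : (l : h × K) = ((l : h × K).1, κ) := Prod.ext rfl hl.2
    rw [mode_expVec _ _ _ _ _ _ hneg, hε.apply_neg_right, hε.diag l M hnorm, add_neg_cancel,
      neg_neg, sub_neg_eq_add, ← hl']
  have hbij : Set.BijOn (fun l : L => (l : h × K).1)
      {l : L | (l : h × K).1 ∈ MulAction.orbit P.weylGroup lam ∧ (l : h × K).2 = κ}
      (MulAction.orbit P.weylGroup lam) := by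
    refine ⟨fun l hl => hl.1, fun l hl l' hl' heq => ?_, fun x hx => ?_⟩
    · exact Subtype.ext (Prod.ext heq (hl.2.trans hl'.2.symm))
    · exact ⟨⟨(x, κ), hL x hx⟩, ⟨hx, rfl⟩, rfl⟩
  refine (finsum_mem_eq_of_bijOn
    (g := fun x => (Finsupp.single 0 (s • schur (x, κ) (M + d - 1)) : VL L)) _ hbij hterm).trans ?_
  rw [finsum_mem_eq_finite_toFinset_sum _ hfin, Finset.smul_sum, ← Finsupp.singleAddHom_apply,
    map_sum]
  rfl

end Nu

end LatticeVOA

end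

theorem proposition2p1 {ι h N : Type*} [Finite ι] [AddCommGroup h] [Module ℂ h]
    [AddCommGroup N] [Module ℂ N]
    (P : RootPairing ι ℂ h N) [P.IsRootSystem] [P.IsCrystallographic] [P.IsReduced]
    [P.IsIrreducible]
    (B : LinearMap.BilinForm ℂ h) (hsymm : B.IsSymm)
    (hinv : ∀ i x y, B (P.reflection i x) (P.reflection i y) = B x y)
    (hnorm : ∀ i, B (P.root i) (P.root i) = 2)
    (εQ : LatticeVOA.rootLattice P → LatticeVOA.rootLattice P → ℤˣ)
    (hεQ : LatticeVOA.IsCocycle B (LatticeVOA.rootLattice P) εQ)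
    (lam₀ : h) (hlam₀ : ∀ i, B lam₀ (P.root i) ∈ ({0, 1, -1} : Set ℂ)) :
    (∀ n : ℤ, (n : ℂ) ≠ B lam₀ lam₀ →
      ∃ (C : LinearMap.BilinForm ℂ ℂ) (L : AddSubgroup (h × ℂ)) (ε : L → L → ℤˣ) (κ : ℂ),
        LatticeVOA.IsLatticeExtension B (LatticeVOA.rootLattice P) εQ C L ε ∧
        (lam₀, κ) ∈ L ∧ LatticeVOA.prodForm B C (lam₀, κ) (lam₀, κ) = n) ∧
    ∀ {K : Type*} [AddCommGroup K] [Module ℂ K] (C : LinearMap.BilinForm ℂ K)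
      (L : AddSubgroup (h × K)) (ε : L → L → ℤˣ) (κ : K)
      (hL : LatticeVOA.IsLatticeExtension B (LatticeVOA.rootLattice P) εQ C L ε)
      (_ : (lam₀, κ) ∈ L) (d : ℕ) (_ : 1 ≤ d),
      (∀ (α : LatticeVOA.rootLattice P), (α : h) ∈ Set.range P.root →
        LatticeVOA.mode (LatticeVOA.prodForm B C) ε ⟨((α : h), 0), hL.incl α⟩ 0
          (LatticeVOA.nu P B C L ε lam₀ κ d) = 0) ∧
      ∃ x : LatticeVOA.Fock (h × K),
        LatticeVOA.nu P B C L ε lam₀ κ d = Finsupp.single 0 x ∧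
        Finsupp.single 0 (LatticeVOA.Fock.map (LinearMap.fst ℂ h K) x) ∈
          LatticeVOA.WAlgebra P B εQ := by
  have hint (i : ι) : ∃ n : ℤ, B lam₀ (P.root i) = n := by
    rcases hlam₀ i with h | h | h
    · exact ⟨0, by simpa using h⟩
    · exact ⟨1, by simpa using h⟩
    · exact ⟨-1, by simpa using h⟩
  refine ⟨fun n hn => ?_, ?_⟩
  · refine LatticeVOA.exists_lift
      (LatticeVOA.isIntegralLattice_rootLattice hsymm hinv hnorm)
      (fun x hx => LatticeVOA.rootLattice_even hsymm hinv hnorm hx) hεQ (fun x hx => ?_) hn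
    rw [hsymm.eq]
    exact LatticeVOA.integral_of_rootLattice hint hx
  intro K _ _ C L ε κ hL hκ d _
  have hfin : (MulAction.orbit P.weylGroup lam₀).Finite :=
    LatticeVOA.finite_orbit_weylGroup hinv hnorm (Set.toFinite _) hlam₀
  have hmem : ∀ x ∈ MulAction.orbit P.weylGroup lam₀, (x, κ) ∈ L := by
    intro x hx
    have hsub := hL.incl ⟨x - lam₀, LatticeVOA.sub_mem_rootLattice_of_mem_orbit hinv hnorm hint hx⟩
    simpa using add_mem hsub hκ
  obtain ⟨M, hM⟩ := hL.lattice.integral _ hκ _ hκ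
  rw [LatticeVOA.prodForm_apply] at hM
  have hpair (i : ι) (x : h) (hx : x ∈ hfin.toFinset) :
      B (P.root i) x ∈ ({0, 1, -1} : Set ℂ) := by
    rw [hsymm.eq]
    exact LatticeVOA.form_root_mem_of_mem_orbit hinv hlam₀ (hfin.mem_toFinset.1 hx) i
  have hrefl (i : ι) (x : h) (hx : x ∈ hfin.toFinset) :
      x - B (P.root i) x • P.root i ∈ hfin.toFinset := by
    rw [hsymm.eq, ← LatticeVOA.reflection_eq_sub hinv hnorm, hfin.mem_toFinset]
    exact LatticeVOA.reflection_mem_orbit i (hfin.mem_toFinset.1 hx)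
  rw [LatticeVOA.nu_eq hL.cocycle hM hinv hmem hfin d]
  refine ⟨?_, _, rfl, ⟨_, rfl⟩, ?_⟩
  · rintro ⟨_, hα⟩ ⟨i, rfl⟩
    have hform (x : h) : LatticeVOA.prodForm B C (P.root i, 0) (x, κ) = B (P.root i) x := by
      simp [LatticeVOA.prodForm_apply]
    have hscreen := LatticeVOA.mode_zero_sum_schur (LatticeVOA.prodForm B C) ε
      ⟨(P.root i, 0), hL.incl ⟨_, hα⟩⟩ (by simp [LatticeVOA.prodForm_apply, hnorm])
      (hfin.toFinset.map ⟨fun x => (x, κ), fun _ _ hxy => congrArg Prod.fst hxy⟩)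
      (fun l hl => ?_) (fun l hl => ?_)
    · simp only [Finset.sum_map] at hscreen
      exact hscreen _ _
    · obtain ⟨x, hx, rfl⟩ := Finset.mem_map.1 hl
      exact (hform x).symm ▸ hpair i x hx
    · obtain ⟨x, hx, rfl⟩ := Finset.mem_map.1 hl
      refine Finset.mem_map.2 ⟨_, hrefl i x hx, ?_⟩
      change (x - B (P.root i) x • P.root i, κ) =
        (x, κ) - LatticeVOA.prodForm B C (P.root i, 0) (x, κ) • (P.root i, (0 : K))
      rw [hform]
      simp
  · rintro ⟨_, hα⟩ ⟨i, rfl⟩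
    rw [map_smul, map_sum]
    simp only [LatticeVOA.map_schur, LinearMap.fst_apply]
    exact LatticeVOA.mode_zero_sum_schur B εQ ⟨P.root i, hα⟩ (hnorm i) hfin.toFinset (hpair i)
      (hrefl i) _ _
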